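/- A rational function $A\in\mathbb C(z)$ is regarded as a holomorphic map $A:\mathbb{CP}^1\to\mathbb{CP}^1$, and $A^{\circ k}$ denotes its $k$-th iterate. Let $G(A)$ be the group of Möbius transformations $\sigma\in\mathrm{Aut}(\mathbb{CP}^1)$ such that $A\circ\sigma=\nu_\sigma\circ A$ for some Möbius transformation $\nu_\sigma$ (which is then unique if $A$ is non-constant), and let $\widehat G(A)$ be the image of the homomorphism $\gamma_A:G(A)\to\mathrm{Aut}(\mathbb{CP}^1)$, $\sigma\mapsto\nu_\sigma$. Let $\Sigma(A)$ and $\mathrm{Aut}(A)$ be the subgroups of $G(A)$ consisting of those $\sigma$ with $A\circ\sigma=A$ and with $A\circ\sigma=\sigma\circ A$, respectively, and let $\Sigma_\infty(A)=\bigcup_{k=1}^\infty\Sigma(A^{\circ k})$, which is a group since $\Sigma(A^{\circ k})\subseteq\Sigma(A^{\circ(k+1)})$ for all $k\ge 1$. The function $A$ is called indecomposable if it is not a composition of two rational functions of degree at least two. **Theorem.** Let $A$ be an indecomposable rational function of degree at least two. 1. If the group $\widehat G(A)$ is trivial, then $\Sigma_\infty(A)=\Sigma(A)$. 2. In particular,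 if the group $G(A)$ is trivial, then the group $\Sigma_\infty(A)$ is trivial. 3. If $G(A)=\mathrm{Aut}(A)$, then the group $\Sigma_\infty(A)$ is trivial. -/

import Mathlib

open scoped IntermediateField

/-- Nonconstant rational functions `f ∈ ℂ(z)`, viewed as the nonconstant holomorphic self-maps
of `ℂℙ¹`. (Every rational function of degree at least one is of this kind.) -/
@[ext]
structure RatMap where
  /-- the underlying element of the field `ℂ(z)` -/
  fn : RatFunc ℂ
  /-- it is not a constant -/
  nonconst : ¬ ∃ c : ℂ, fn = RatFunc.C c

namespace RatMap

/-- The degree of a rational function: the maximum of the degrees of the numerator and the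
denominator in lowest terms. -/
noncomputable def degree (f : RatMap) : ℕ :=
  max f.fn.num.natDegree f.fn.denom.natDegree

theorem transcendental (f : RatMap) : Transcendental ℂ f.fn :=
  f.fn.transcendental_of_ne_C f.nonconst

/-- Substitution `f ↦ f ∘ g`, as an embedding of the field `ℂ(z)` into itself. -/
noncomputable def subst (g : RatMap) : RatFunc ℂ →ₐ[ℂ] RatFunc ℂ :=
  (ℂ⟮g.fn⟯.val).comp (RatFunc.algEquivOfTranscendental g.fn g.transcendental).toAlgHom

theorem subst_apply (g : RatMap) (f : RatFunc ℂ) :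
    g.subst f = RatFunc.eval RatFunc.C g.fn f := by
  simpa [subst, RatFunc.eval, Polynomial.aeval_def] using
    RatFunc.algEquivOfTranscendental_apply g.fn g.transcendental f

theorem subst_C (g : RatMap) (c : ℂ) : g.subst (RatFunc.C c) = RatFunc.C c := by
  rw [subst_apply, RatFunc.eval_C]

theorem subst_X (g : RatMap) : g.subst RatFunc.X = g.fn := by
  rw [subst_apply, RatFunc.eval_X]

theorem subst_injective (g : RatMap) : Function.Injective g.subst :=
  g.subst.toRingHom.injective

theorem mem_adjoin_iff (g : RatMap) (h : RatFunc ℂ) : h ∈ ℂ⟮g.fn⟯ ↔ ∃ f, g.subst f = h := by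
  constructor
  · intro hh
    obtain ⟨f, hf⟩ := (RatFunc.algEquivOfTranscendental g.fn g.transcendental).surjective ⟨h, hh⟩
    exact ⟨f, congrArg Subtype.val hf⟩
  · rintro ⟨f, rfl⟩
    exact ((RatFunc.algEquivOfTranscendental g.fn g.transcendental) f).2

/-- The composition `f ∘ g`: the quotient `p(g) / q(g)`, where `f = p / q` in lowest terms. -/
noncomputable def comp (f g : RatMap) : RatMap where
  fn := RatFunc.eval RatFunc.C g.fn f.fn
  nonconst := by
    rintro ⟨c, hc⟩
    rw [← subst_apply, ← subst_C g c] at hc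
    exact f.nonconst ⟨c, g.subst_injective hc⟩

theorem comp_fn (f g : RatMap) : (f.comp g).fn = g.subst f.fn := (subst_apply g f.fn).symm

theorem subst_comp (f g : RatMap) (h : RatFunc ℂ) :
    (f.comp g).subst h = g.subst (f.subst h) := by
  have hC : (g.subst : RatFunc ℂ →+* RatFunc ℂ).comp RatFunc.C = RatFunc.C :=
    RingHom.ext fun c => subst_C g c
  have hp (p : Polynomial ℂ) : g.subst (p.eval₂ RatFunc.C f.fn) =
      p.eval₂ RatFunc.C (f.comp g).fn := by
    have := Polynomial.hom_eval₂ p RatFunc.C (g.subst : RatFunc ℂ →+* RatFunc ℂ) f.fn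
    rw [hC] at this
    rw [comp_fn]
    exact this
  rw [subst_apply (f.comp g), subst_apply f, RatFunc.eval, RatFunc.eval, map_div₀, hp, hp]

/-- The identity map `z`. -/
noncomputable def ident : RatMap where
  fn := RatFunc.X
  nonconst := by
    rintro ⟨c, hc⟩
    have := congrArg (fun f => f.num.natDegree) hc
    simp at this

/-- Nonconstant rational functions form a monoid under composition. So `f * g` is `f ∘ g`, and
`f ^ k` is the `k`-th iterate of `f`. -/
noncomputable instance : Monoid RatMap where
  mul := comp
  one := ident
  mul_assoc f g h := RatMap.ext <| by
    change ((f.comp g).comp h).fn = (f.comp (g.comp h)).fn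
    rw [comp_fn, comp_fn, comp_fn, subst_comp]
  one_mul f := RatMap.ext <| by
    change (ident.comp f).fn = f.fn
    rw [comp_fn]
    exact subst_X f
  mul_one f := RatMap.ext <| by
    change (f.comp ident).fn = f.fn
    have h := subst_apply ident f.fn
    rw [comp_fn, h, RatFunc.eval]
    change Polynomial.eval₂ RatFunc.C RatFunc.X _ / Polynomial.eval₂ RatFunc.C RatFunc.X _ = _
    rw [← RatFunc.algebraMap_eq_C, ← Polynomial.aeval_def, ← Polynomial.aeval_def,
      RatFunc.aeval_X_left_eq_algebraMap, RatFunc.aeval_X_left_eq_algebraMap,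
      RatFunc.num_div_denom]

theorem mul_def (f g : RatMap) : f * g = f.comp g := rfl

theorem mul_right_cancel {f g h : RatMap} (e : f * h = g * h) : f = g :=
  RatMap.ext <| h.subst_injective <| by
    rw [← comp_fn, ← comp_fn, ← mul_def, ← mul_def, e]

/-- The rational functions that are invertible under composition are those of degree one. -/
theorem isUnit_iff_degree_eq_one (f : RatMap) : IsUnit f ↔ f.degree = 1 := by
  have key : f.degree = 1 ↔ RatFunc.X ∈ ℂ⟮f.fn⟯ := by
    rw [degree, ← RatFunc.finrank_eq_max_natDegree, IntermediateField.finrank_eq_one_iff_eq_top]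
    constructor
    · intro h
      rw [h]
      trivial
    · intro h
      rw [eq_top_iff, ← RatFunc.adjoin_X]
      exact IntermediateField.adjoin_simple_le_iff.mpr h
  rw [key, mem_adjoin_iff]
  constructor
  · rintro ⟨u, rfl⟩
    refine ⟨(↑u⁻¹ : RatMap).fn, ?_⟩
    rw [← comp_fn, ← mul_def, Units.inv_mul]
    rfl
  · rintro ⟨g, hg⟩
    have hgc : ¬ ∃ c : ℂ, g = RatFunc.C c := by
      rintro ⟨c, rfl⟩
      rw [subst_C] at hg
      exact ident.nonconst ⟨c, hg.symm⟩
    have h1 : (⟨g, hgc⟩ : RatMap) * f = 1 := RatMap.ext ((comp_fn _ f).trans hg)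
    have h2 : f * ⟨g, hgc⟩ = 1 := mul_right_cancel (h := f) (by
      rw [mul_assoc, h1, mul_one, one_mul])
    exact ⟨⟨f, ⟨g, hgc⟩, h2, h1⟩, rfl⟩

/-- `A` is indecomposable: it is not a composition of two rational functions of degree at
least two. -/
def Indecomposable (A : RatMap) : Prop :=
  ¬ ∃ U V : RatMap, 2 ≤ U.degree ∧ 2 ≤ V.degree ∧ A = U * V

end RatMap

/-- The group `Aut(ℂℙ¹)` of Möbius transformations: the rational functions that are invertible
under composition, equivalently those of degree one (`RatMap.isUnit_iff_degree_eq_one`). -/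
abbrev Moebius : Type := RatMapˣ

namespace RatMap

/-- `Σ(A)`: the Möbius transformations `σ` with `A ∘ σ = A`. -/
def symSigma (A : RatMap) : Subgroup Moebius where
  carrier := {σ | A * (σ : RatMap) = A}
  one_mem' := by simp
  mul_mem' := by
    intro σ τ hσ hτ
    simp only [Set.mem_ofPred_eq, Units.val_mul] at *
    rw [← mul_assoc, hσ, hτ]
  inv_mem' := by
    intro σ hσ
    simp only [Set.mem_ofPred_eq] at *
    rw [Units.mul_inv_eq_iff_eq_mul, hσ]

/-- `Aut(A)`: the Möbius transformations `σ` with `A ∘ σ = σ ∘ A`. -/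
def symAut (A : RatMap) : Subgroup Moebius where
  carrier := {σ | A * (σ : RatMap) = σ * A}
  one_mem' := by simp
  mul_mem' := by
    intro σ τ hσ hτ
    simp only [Set.mem_ofPred_eq, Units.val_mul] at *
    rw [← mul_assoc, hσ, mul_assoc, hτ, mul_assoc]
  inv_mem' := by
    intro σ hσ
    simp only [Set.mem_ofPred_eq] at *
    rw [Units.mul_inv_eq_iff_eq_mul, mul_assoc, hσ, Units.inv_mul_cancel_left]

theorem mul_inv_of_semiconj {A : RatMap} {σ ν : Moebius} (h : A * (σ : RatMap) = ν * A) :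
    A * ((σ⁻¹ : Moebius) : RatMap) = (ν⁻¹ : Moebius) * A := by
  rw [Units.mul_inv_eq_iff_eq_mul, mul_assoc, h, Units.inv_mul_cancel_left]

theorem mul_mul_of_semiconj {A : RatMap} {σ τ ν μ : Moebius} (h : A * (σ : RatMap) = ν * A)
    (h' : A * (τ : RatMap) = μ * A) :
    A * ((σ * τ : Moebius) : RatMap) = (ν * μ : Moebius) * A := by
  rw [Units.val_mul, Units.val_mul, ← mul_assoc, h, mul_assoc, h', mul_assoc]

/-- `G(A)`: the Möbius transformations `σ` with `A ∘ σ = ν ∘ A` for some Möbius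
transformation `ν`. -/
def symG (A : RatMap) : Subgroup Moebius where
  carrier := {σ | ∃ ν : Moebius, A * (σ : RatMap) = ν * A}
  one_mem' := ⟨1, by simp⟩
  mul_mem' := by
    rintro σ τ ⟨ν, hν⟩ ⟨μ, hμ⟩
    exact ⟨ν * μ, mul_mul_of_semiconj hν hμ⟩
  inv_mem' := by
    rintro σ ⟨ν, hν⟩
    exact ⟨ν⁻¹, mul_inv_of_semiconj hν⟩

/-- The homomorphism `γ_A : G(A) → Aut(ℂℙ¹)`, which sends `σ` to the unique `ν` with
`A ∘ σ = ν ∘ A`. -/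
noncomputable def gam (A : RatMap) : A.symG →* Moebius where
  toFun σ := σ.2.choose
  map_one' := Units.ext <| mul_right_cancel (h := A) <|
    ((1 : A.symG).2.choose_spec).symm.trans (by simp)
  map_mul' σ τ := Units.ext <| mul_right_cancel (h := A) <|
    ((σ * τ).2.choose_spec).symm.trans
      (mul_mul_of_semiconj σ.2.choose_spec τ.2.choose_spec)

/-- `Ĝ(A)`: the image of `γ_A`. -/
noncomputable def symGHat (A : RatMap) : Subgroup Moebius := A.gam.range

theorem symSigma_pow_mono (A : RatMap) {k l : ℕ} (h : k ≤ l) :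
    (A ^ k).symSigma ≤ (A ^ l).symSigma := by
  intro σ (hσ : A ^ k * (σ : RatMap) = A ^ k)
  change A ^ l * (σ : RatMap) = A ^ l
  rw [← Nat.sub_add_cancel h, pow_add, mul_assoc, hσ]

/-- `Σ_∞(A)`: the union of the groups `Σ(A^{∘k})` over `k ≥ 1`. -/
def symSigmaInf (A : RatMap) : Subgroup Moebius where
  carrier := {σ | ∃ k : ℕ, 1 ≤ k ∧ σ ∈ (A ^ k).symSigma}
  one_mem' := ⟨1, le_rfl, one_mem _⟩
  mul_mem' := by
    rintro σ τ ⟨k, hk, hσ⟩ ⟨l, -, hτ⟩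
    exact ⟨max k l, hk.trans (le_max_left k l),
      mul_mem (A.symSigma_pow_mono (le_max_left k l) hσ)
        (A.symSigma_pow_mono (le_max_right k l) hτ)⟩
  inv_mem' := by
    rintro σ ⟨k, hk, hσ⟩
    exact ⟨k, hk, inv_mem hσ⟩

end RatMap

/-! The heart of the matter is that `Σ(A) = 1` forces `Σ_∞(A) = 1`. By Lüroth's theorem `A` is
indecomposable exactly when `ℂ(z)` has no intermediate fields over `K = ℂ(A)`. If `A ∘ Y = A ∘ B`
with `B ∈ K`, then `Y` and `B` are roots of the polynomial `p - A(B) q` over `K`, where `A = p / q`;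
its degree is at most `[ℂ(z) : K]` and it has the root `B` in `K`, so `Y` cannot generate `ℂ(z)`
over `K` and lies in `K`. Thus `A ∘ Y = A^{∘(m+1)}` gives `Y = R ∘ A` with `A ∘ R = A^{∘m}`, and by
descent `Y = A^{∘m}`.

A nontrivial `σ ∈ Σ(A)` has fixed field exactly `K`. Whatever commutes with `σ` preserves this
field, so the centralizer of `σ` in `Aut(ℂℙ¹)` lies in `G(A)`. That centralizer is infinite, since
it contains the classes of the matrices `t - g` for a matrix `g` of `σ`, while `Σ(A)` is finite;
hence `G(A) ≠ Σ(A)`, and `Ĝ(A)` is not trivial. -/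

open Polynomial IntermediateField Matrix

theorem mem_bot_of_aeval_eq_zero_of_isRoot {K L : Type*} [Field K] [Field L] [Algebra K L]
    (hKL : ∀ F : IntermediateField K L, F = ⊥ ∨ F = ⊤) {P : K[X]} (hP : P ≠ 0)
    (hdeg : P.natDegree ≤ Module.finrank K L) {b : K} (hb : P.IsRoot b) {y : L}
    (hy : aeval y P = 0) : y ∈ (⊥ : IntermediateField K L) := by
  by_contra hyK
  have hgen : K⟮y⟯ = ⊤ := (hKL _).resolve_left (mt adjoin_simple_eq_bot_iff.mp hyK)
  obtain ⟨Q, rfl⟩ := dvd_iff_isRoot.mpr hb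
  have hQ : Q ≠ 0 := right_ne_zero_of_mul hP
  have hyQ : aeval y Q = 0 := by
    rw [map_mul, map_sub, aeval_X, aeval_C] at hy
    refine (mul_eq_zero.mp hy).resolve_left fun h => hyK ?_
    exact mem_bot.mpr ⟨b, (sub_eq_zero.mp h).symm⟩
  have hfinrank : Module.finrank K L ≤ Q.natDegree :=
    calc
      Module.finrank K L = (minpoly K y).natDegree := by
        rw [← adjoin.finrank (IsAlgebraic.isIntegral ⟨Q, hQ, hyQ⟩), hgen, finrank_top']
      _ ≤ Q.natDegree := natDegree_le_of_dvd (minpoly.dvd K y hyQ) hQ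
  rw [natDegree_mul (X_sub_C_ne_zero b) hQ, natDegree_X_sub_C] at hdeg
  omega

section FiberPoly

variable {k K : Type*} [Field k] [Field K] [Algebra k K]

/-- For `f = p / q` in lowest terms, the polynomial `p - w q`, whose roots are the solutions `y` of
`f(y) = w`. The value `w` lies in an arbitrary extension of the field of constants. -/
noncomputable def fiberPoly (f : RatFunc k) (w : K) : K[X] :=
  f.num.map (algebraMap k K) - C w * f.denom.map (algebraMap k K)

theorem natDegree_fiberPoly_le (f : RatFunc k) (w : K) :
    (fiberPoly f w).natDegree ≤ max f.num.natDegree f.denom.natDegree :=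
  (natDegree_sub_le _ _).trans <|
    max_le_max natDegree_map_le ((natDegree_C_mul_le _ _).trans natDegree_map_le)

theorem fiberPoly_ne_zero (f : RatFunc k) {w : K} (hw : w ∉ (algebraMap k K).range) :
    fiberPoly f w ≠ 0 := by
  intro h
  have hlead : algebraMap k K f.denom.leadingCoeff ≠ 0 :=
    (_root_.map_ne_zero _).mpr (leadingCoeff_ne_zero.mpr f.denom_ne_zero)
  have hcoeff := congrArg (coeff · f.denom.natDegree) h
  simp only [fiberPoly, coeff_sub, coeff_map, coeff_C_mul, coeff_zero, coeff_natDegree,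
    sub_eq_zero] at hcoeff
  refine hw ⟨f.num.coeff f.denom.natDegree / f.denom.leadingCoeff, ?_⟩
  rw [map_div₀, hcoeff, mul_div_cancel_right₀ _ hlead]

theorem aeval_fiberPoly_eq_zero_iff {L : Type*} [Field L] [Algebra k L] [Algebra K L]
    [IsScalarTower k K L] {f : RatFunc k} {w : K} {y : L} (hy : aeval y f.denom ≠ 0) :
    aeval y (fiberPoly f w) = 0 ↔ aeval y f.num / aeval y f.denom = algebraMap K L w := by
  rw [fiberPoly, map_sub, map_mul, aeval_map_algebraMap, aeval_map_algebraMap, aeval_C,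
    sub_eq_zero, ← div_eq_iff hy]

end FiberPoly

namespace RatMap

theorem one_fn : (1 : RatMap).fn = RatFunc.X := rfl

theorem mul_fn (f g : RatMap) : (f * g).fn = g.subst f.fn := comp_fn f g

instance : IsRightCancelMul RatMap := ⟨fun _ _ _ => mul_right_cancel⟩

theorem fn_mem_adjoin_iff {f g : RatMap} : f.fn ∈ ℂ⟮g.fn⟯ ↔ ∃ u : RatMap, f = u * g := by
  rw [mem_adjoin_iff]
  constructor
  · rintro ⟨r, hr⟩
    have hr_nonconst : ¬ ∃ c : ℂ, r = RatFunc.C c := by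
      rintro ⟨c, rfl⟩
      exact f.nonconst ⟨c, by rw [← hr, subst_C]⟩
    exact ⟨⟨r, hr_nonconst⟩, RatMap.ext (by rw [mul_fn, hr])⟩
  · rintro ⟨u, rfl⟩
    exact ⟨u.fn, (mul_fn u g).symm⟩

theorem adjoin_unit_mul (u : Moebius) (f : RatMap) : ℂ⟮(u * f : RatMap).fn⟯ = ℂ⟮f.fn⟯ := by
  apply le_antisymm <;> rw [adjoin_simple_le_iff, fn_mem_adjoin_iff]
  · exact ⟨u, rfl⟩
  · exact ⟨(u⁻¹ : Moebius), (u.inv_mul_cancel_left f).symm⟩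

theorem degree_ne_zero (f : RatMap) : f.degree ≠ 0 := fun h =>
  f.nonconst ((RatFunc.eq_C_iff f.fn).mpr (Nat.max_eq_zero_iff.mp h))

theorem isUnit_or_two_le_degree (f : RatMap) : IsUnit f ∨ 2 ≤ f.degree := by
  have := f.degree_ne_zero
  rw [isUnit_iff_degree_eq_one]
  omega

theorem exists_adjoin_eq {F : IntermediateField ℂ (RatFunc ℂ)} (hF : F ≠ ⊥) :
    ∃ V : RatMap, ℂ⟮V.fn⟯ = F :=
  ⟨⟨RatFunc.Luroth.generator F, RatFunc.Luroth.generator_ne_C hF⟩,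
    RatFunc.Luroth.eq_adjoin_generator.symm⟩

theorem Indecomposable.eq_adjoin_or_eq_top {A : RatMap} (hA : A.Indecomposable)
    {F : IntermediateField ℂ (RatFunc ℂ)} (hF : A.fn ∈ F) : F = ℂ⟮A.fn⟯ ∨ F = ⊤ := by
  have hbot : F ≠ ⊥ := by
    rintro rfl
    obtain ⟨c, hc⟩ := mem_bot.mp hF
    exact A.nonconst ⟨c, hc.symm⟩
  obtain ⟨V, rfl⟩ := exists_adjoin_eq hbot
  obtain ⟨U, rfl⟩ := fn_mem_adjoin_iff.mp hF
  rcases U.isUnit_or_two_le_degree with ⟨u, rfl⟩ | hU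
  · exact .inl (adjoin_unit_mul u V).symm
  rcases V.isUnit_or_two_le_degree with ⟨v, rfl⟩ | hV
  · right
    simpa [one_fn, RatFunc.adjoin_X] using adjoin_unit_mul v 1
  · exact absurd ⟨U, V, hU, hV, rfl⟩ hA

theorem Indecomposable.eq_bot_or_eq_top {A : RatMap} (hA : A.Indecomposable)
    (F : IntermediateField ℂ⟮A.fn⟯ (RatFunc ℂ)) : F = ⊥ ∨ F = ⊤ := by
  have hAF : A.fn ∈ F.restrictScalars ℂ := F.algebraMap_mem (AdjoinSimple.gen ℂ A.fn)
  refine (hA.eq_adjoin_or_eq_top hAF).imp (fun h => ?_) restrictScalars_eq_top_iff.mp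
  refine eq_bot_iff.mpr fun x hx => mem_bot.mpr ⟨⟨x, ?_⟩, rfl⟩
  rwa [← h]

theorem notMem_range_algebraMap (f : RatMap) : f.fn ∉ (algebraMap ℂ (RatFunc ℂ)).range :=
  fun ⟨c, hc⟩ => f.nonconst ⟨c, hc.symm⟩

theorem aeval_fiberPoly_eq_zero {K : Type*} [Field K] [Algebra ℂ K] [Algebra K (RatFunc ℂ)]
    [IsScalarTower ℂ K (RatFunc ℂ)] {A Y : RatMap} {w : K}
    (h : (A * Y).fn = algebraMap K (RatFunc ℂ) w) : aeval Y.fn (fiberPoly A.fn w) = 0 := by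
  have hdenom : aeval Y.fn A.fn.denom ≠ 0 := fun h0 =>
    A.fn.denom_ne_zero (transcendental_iff.mp Y.transcendental _ h0)
  exact (aeval_fiberPoly_eq_zero_iff hdenom).mpr h

theorem Indecomposable.exists_eq_mul_of_mul_eq {A Y S : RatMap} (hA : A.Indecomposable)
    (h : A * Y = A * (S * A)) : ∃ R : RatMap, Y = R * A := by
  have hb : (S * A).fn ∈ ℂ⟮A.fn⟯ := fn_mem_adjoin_iff.mpr ⟨S, rfl⟩
  have hw : (A * (S * A)).fn ∈ ℂ⟮A.fn⟯ := fn_mem_adjoin_iff.mpr ⟨A * S, (mul_assoc ..).symm⟩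
  let b : ℂ⟮A.fn⟯ := ⟨_, hb⟩
  let w : ℂ⟮A.fn⟯ := ⟨_, hw⟩
  have hP : fiberPoly A.fn w ≠ 0 := fiberPoly_ne_zero _ fun ⟨c, hc⟩ =>
    (A * (S * A)).nonconst ⟨c, (congrArg Subtype.val hc).symm⟩
  have hdeg : (fiberPoly A.fn w).natDegree ≤ Module.finrank ℂ⟮A.fn⟯ (RatFunc ℂ) :=
    (natDegree_fiberPoly_le _ _).trans (RatFunc.finrank_eq_max_natDegree A.fn).ge
  have hroot : (fiberPoly A.fn w).IsRoot b := by
    refine Subtype.ext ?_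
    exact (aeval_algebraMap_apply_eq_algebraMap_eval (A := RatFunc ℂ) b _).symm.trans
      (aeval_fiberPoly_eq_zero rfl)
  obtain ⟨y, hy⟩ := mem_bot.mp <| mem_bot_of_aeval_eq_zero_of_isRoot hA.eq_bot_or_eq_top hP hdeg
    hroot (aeval_fiberPoly_eq_zero (congrArg fn h))
  exact fn_mem_adjoin_iff.mp (hy ▸ y.2)

theorem finite_setOf_mul_eq (A B : RatMap) : {Y : RatMap | A * Y = B}.Finite := by
  have hP : fiberPoly A.fn B.fn ≠ 0 := fiberPoly_ne_zero _ B.notMem_range_algebraMap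
  refine Set.Finite.of_finite_image (f := fn) ?_ fun _ _ _ _ h => RatMap.ext h
  refine ((fiberPoly A.fn B.fn).rootSet_finite (RatFunc ℂ)).subset ?_
  rintro _ ⟨Y, hY, rfl⟩
  exact (mem_rootSet_of_ne hP).mpr (aeval_fiberPoly_eq_zero (congrArg fn hY))

theorem finite_symSigma (A : RatMap) : (A.symSigma : Set Moebius).Finite :=
  (A.finite_setOf_mul_eq A).preimage (f := Units.val) Units.val_injective.injOn

theorem isUnit_of_mul_eq_left {A Y : RatMap} (h : A * Y = A) : IsUnit Y := by
  have hpow (n : ℕ) : A * Y ^ n = A := by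
    induction n with
    | zero => rw [pow_zero, mul_one]
    | succ n ih => rw [pow_succ, ← mul_assoc, ih, h]
  obtain ⟨i, j, hij, he⟩ := (A.finite_setOf_mul_eq A).exists_lt_map_eq_of_forall_mem hpow
  refine .of_pow_eq_one (n := j - i) (mul_right_cancel (h := Y ^ i) ?_) (by omega)
  rw [← pow_add, Nat.sub_add_cancel hij.le, one_mul, he]

theorem Indecomposable.eq_pow_of_mul_eq_pow_succ {A : RatMap} (hA : A.Indecomposable)
    (hS : A.symSigma = ⊥) {m : ℕ} {Y : RatMap} (h : A * Y = A ^ (m + 1)) : Y = A ^ m := by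
  induction m generalizing Y with
  | zero =>
    rw [zero_add, pow_one] at h
    obtain ⟨σ, rfl⟩ := isUnit_of_mul_eq_left h
    have hσ : σ ∈ A.symSigma := h
    rw [hS, Subgroup.mem_bot] at hσ
    rw [hσ, Units.val_one, pow_zero]
  | succ m ih =>
    obtain ⟨R, rfl⟩ := hA.exists_eq_mul_of_mul_eq (S := A ^ m) (by rw [h, pow_succ', pow_succ])
    have hR : A * R = A ^ (m + 1) := mul_right_cancel (h := A) (by rw [mul_assoc, h, pow_succ])
    rw [ih hR, pow_succ]

theorem Indecomposable.symSigmaInf_eq_bot {A : RatMap} (hA : A.Indecomposable)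
    (hS : A.symSigma = ⊥) : A.symSigmaInf = ⊥ := by
  rw [Subgroup.eq_bot_iff_forall]
  rintro σ ⟨k, -, hσ : A ^ k * (σ : RatMap) = A ^ k⟩
  induction k with
  | zero => simpa using hσ
  | succ k ih =>
    refine ih (hA.eq_pow_of_mul_eq_pow_succ hS ?_)
    rw [← mul_assoc, ← pow_succ', hσ]

/-- The field of rational functions `f` with `f ∘ σ = f`. -/
noncomputable def invariantField (σ : RatMap) : IntermediateField ℂ (RatFunc ℂ) :=
  (AlgHom.equalizer σ.subst (AlgHom.id ℂ _)).toIntermediateField fun x hx => by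
    rw [AlgHom.mem_equalizer] at hx ⊢
    rw [map_inv₀, map_inv₀, hx]

theorem fn_mem_invariantField {σ f : RatMap} : f.fn ∈ σ.invariantField ↔ f * σ = f := by
  rw [RatMap.ext_iff, mul_fn]
  rfl

theorem Indecomposable.exists_eq_mul_of_invariant {A B σ : RatMap} (hA : A.Indecomposable)
    (hσ : σ ≠ 1) (hAσ : A * σ = A) (hBσ : B * σ = B) : ∃ ν : RatMap, B = ν * A := by
  have htop : σ.invariantField ≠ ⊤ := fun h => hσ <| by
    rw [← one_mul σ, ← fn_mem_invariantField, h]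
    exact mem_top
  have hfield : σ.invariantField = ℂ⟮A.fn⟯ :=
    (hA.eq_adjoin_or_eq_top (fn_mem_invariantField.mpr hAσ)).resolve_right htop
  rwa [← fn_mem_adjoin_iff, ← hfield, fn_mem_invariantField]

theorem Indecomposable.centralizer_le_symG {A : RatMap} {σ : Moebius} (hA : A.Indecomposable)
    (hσ : σ ∈ A.symSigma) (hσ1 : σ ≠ 1) : Subgroup.centralizer {σ} ≤ A.symG := by
  have hdescend {τ : Moebius} (hτ : τ ∈ Subgroup.centralizer {σ}) :
      ∃ ν : RatMap, A * τ = ν * A := by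
    refine hA.exists_eq_mul_of_invariant (σ := σ) (by simpa using hσ1) hσ ?_
    have hcomm : (τ : RatMap) * σ = σ * τ :=
      congrArg Units.val (Subgroup.mem_centralizer_singleton_iff.mp hτ)
    rw [mul_assoc, hcomm, ← mul_assoc, show A * (σ : RatMap) = A from hσ]
  intro τ hτ
  obtain ⟨ν, hν⟩ := hdescend hτ
  obtain ⟨μ, hμ⟩ := hdescend (inv_mem hτ)
  have hνμ : ν * μ = 1 := mul_right_cancel (h := A) <| by
    rw [mul_assoc, ← hμ, ← mul_assoc, ← hν, Units.mul_inv_cancel_right, one_mul]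
  obtain ⟨ν, rfl⟩ := IsUnit.of_mul_eq_one μ hνμ
  exact ⟨ν, hν⟩

theorem symG_le_symSigma {A : RatMap} (h : A.symGHat = ⊥) : A.symG ≤ A.symSigma := by
  intro σ hσ
  have hγ : A.gam ⟨σ, hσ⟩ = 1 := Subgroup.mem_bot.mp (h ▸ ⟨_, rfl⟩)
  have hAσ : A * (σ : RatMap) = (A.gam ⟨σ, hσ⟩ : Moebius) * A := hσ.choose_spec
  rwa [hγ, Units.val_one, one_mul] at hAσ

theorem symSigma_le_symG (A : RatMap) : A.symSigma ≤ A.symG := fun σ hσ =>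
  ⟨1, by rw [show A * (σ : RatMap) = A from hσ, Units.val_one, one_mul]⟩

theorem symSigma_inf_symAut (A : RatMap) : A.symSigma ⊓ A.symAut = ⊥ := by
  rw [Subgroup.eq_bot_iff_forall]
  rintro σ ⟨hσ : A * (σ : RatMap) = A, hσ' : A * (σ : RatMap) = σ * A⟩
  exact Units.ext (mul_right_cancel (h := A) (by rw [← hσ', hσ, Units.val_one, one_mul]))

theorem C_mul_fn_add_C_eq_zero_iff (f : RatMap) {a b : ℂ} :
    RatFunc.C a * f.fn + RatFunc.C b = 0 ↔ a = 0 ∧ b = 0 := by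
  refine ⟨fun h => ?_, by rintro ⟨rfl, rfl⟩; simp⟩
  have ha : a = 0 := by
    by_contra ha
    have ha' : RatFunc.C a ≠ 0 := (_root_.map_ne_zero _).mpr ha
    refine f.nonconst ⟨-b / a, ?_⟩
    rw [map_div₀, map_neg, eq_div_iff ha']
    linear_combination h
  subst ha
  simpa using h

theorem linearFractional_denom_ne_zero (g : GL (Fin 2) ℂ) (f : RatMap) :
    RatFunc.C (g 1 0) * f.fn + RatFunc.C (g 1 1) ≠ 0 := by
  rw [Ne, C_mul_fn_add_C_eq_zero_iff]
  rintro ⟨hc, hd⟩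
  exact g.det_ne_zero (by rw [det_fin_two, hc, hd, mul_zero, mul_zero, sub_zero])

/-- The rational function `(a z + b) / (c z + d)` of an invertible matrix with rows `(a, b)` and
`(c, d)`. -/
noncomputable def linearFractional (g : GL (Fin 2) ℂ) : RatMap where
  fn := (RatFunc.C (g 0 0) * RatFunc.X + RatFunc.C (g 0 1)) /
    (RatFunc.C (g 1 0) * RatFunc.X + RatFunc.C (g 1 1))
  nonconst := by
    rintro ⟨k, hk⟩
    rw [← one_fn, div_eq_iff (linearFractional_denom_ne_zero g 1)] at hk
    have hlin : RatFunc.C (g 0 0 - k * g 1 0) * (1 : RatMap).fn +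
        RatFunc.C (g 0 1 - k * g 1 1) = 0 := by
      simp only [map_sub, map_mul]
      linear_combination hk
    obtain ⟨ha, hb⟩ := (C_mul_fn_add_C_eq_zero_iff 1).mp hlin
    refine g.det_ne_zero ?_
    rw [det_fin_two]
    linear_combination g 1 1 * ha - g 1 0 * hb

theorem linearFractional_mul_fn (g : GL (Fin 2) ℂ) (f : RatMap) :
    (linearFractional g * f).fn = (RatFunc.C (g 0 0) * f.fn + RatFunc.C (g 0 1)) /
      (RatFunc.C (g 1 0) * f.fn + RatFunc.C (g 1 1)) := by
  simp only [mul_fn, linearFractional, map_div₀, map_add, map_mul, subst_C, subst_X]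

theorem linearFractional_fn_mul (g : GL (Fin 2) ℂ) :
    (linearFractional g).fn * (RatFunc.C (g 1 0) * RatFunc.X + RatFunc.C (g 1 1)) =
      RatFunc.C (g 0 0) * RatFunc.X + RatFunc.C (g 0 1) :=
  div_mul_cancel₀ _ (linearFractional_denom_ne_zero g 1)

theorem linearFractional_mul (g h : GL (Fin 2) ℂ) :
    linearFractional (g * h) = linearFractional g * linearFractional h := by
  refine RatMap.ext ?_
  have hh := linearFractional_fn_mul h
  rw [linearFractional_mul_fn, eq_div_iff (linearFractional_denom_ne_zero g _)]
  refine mul_right_cancel₀ (linearFractional_denom_ne_zero h 1) ?_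
  have hgh := linearFractional_fn_mul (g * h)
  simp only [GeneralLinearGroup.coe_mul, mul_apply, Fin.sum_univ_two, map_add, map_mul] at hgh
  rw [one_fn]
  linear_combination
    hgh + (RatFunc.C (g 1 0) * (linearFractional (g * h)).fn - RatFunc.C (g 0 0)) * hh

theorem linearFractional_eq_one_iff {g : GL (Fin 2) ℂ} :
    linearFractional g = 1 ↔ ∃ c, algebraMap ℂ (Matrix (Fin 2) (Fin 2) ℂ) c = g := by
  have hpoly : linearFractional g = 1 ↔
      C (g 0 0) * X + C (g 0 1) = X * (C (g 1 0) * X + C (g 1 1)) := by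
    rw [RatMap.ext_iff, one_fn, ← (RatFunc.algebraMap_injective ℂ).eq_iff,
      ← mul_left_inj' (linearFractional_denom_ne_zero g 1), one_fn, linearFractional_fn_mul]
    simp only [map_mul, map_add, RatFunc.algebraMap_C, RatFunc.algebraMap_X]
  rw [hpoly]
  constructor
  · intro h
    have h01 : g 0 1 = 0 := by simpa using congrArg (coeff · 0) h
    have hdiag : g 0 0 = g 1 1 := by simpa [coeff_X, coeff_C] using congrArg (coeff · 1) h
    have h10 : g 1 0 = 0 := by simpa [coeff_X, coeff_C] using (congrArg (coeff · 2) h).symm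
    refine ⟨g 0 0, ?_⟩
    ext i j
    fin_cases i <;> fin_cases j <;> simp [algebraMap_matrix_apply, h01, h10, hdiag]
  · rintro ⟨c, hc⟩
    have hentry (i j : Fin 2) : g i j = if i = j then c else 0 := by
      rw [← hc, algebraMap_matrix_apply, Algebra.algebraMap_self_apply]
    simp [hentry, X_mul_C]

/-- The action of `GL₂(ℂ)` on `ℂℙ¹` by Möbius transformations. -/
noncomputable def toMoebius : GL (Fin 2) ℂ →* Moebius :=
  MonoidHom.toHomUnits
    { toFun := linearFractional
      map_one' := linearFractional_eq_one_iff.mpr ⟨1, map_one _⟩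
      map_mul' := linearFractional_mul }

theorem toMoebius_eq_one_iff {g : GL (Fin 2) ℂ} :
    toMoebius g = 1 ↔ ∃ c, algebraMap ℂ (Matrix (Fin 2) (Fin 2) ℂ) c = g :=
  Units.ext_iff.trans linearFractional_eq_one_iff

theorem toMoebius_surjective : Function.Surjective toMoebius := by
  intro σ
  have hdeg : (σ : RatMap).degree = 1 := (isUnit_iff_degree_eq_one σ).mp σ.isUnit
  obtain ⟨a, b, hnum⟩ := exists_eq_X_add_C_of_natDegree_le_one ((le_max_left _ _).trans hdeg.le)
  obtain ⟨c, d, hdenom⟩ := exists_eq_X_add_C_of_natDegree_le_one ((le_max_right _ _).trans hdeg.le)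
  have hσ : (σ : RatMap).fn =
      (RatFunc.C a * RatFunc.X + RatFunc.C b) / (RatFunc.C c * RatFunc.X + RatFunc.C d) := by
    rw [← RatFunc.num_div_denom (σ : RatMap).fn, hnum, hdenom]
    simp only [map_mul, map_add, RatFunc.algebraMap_C, RatFunc.algebraMap_X]
  have hdet : (!![a, b; c, d]).det ≠ 0 := by
    rw [det_fin_two_of]
    intro h0
    have hcd : RatFunc.C c * RatFunc.X + RatFunc.C d ≠ 0 := by
      simpa [hdenom] using RatFunc.algebraMap_ne_zero (σ : RatMap).fn.denom_ne_zero
    rw [eq_div_iff hcd] at hσ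
    have hdet0 : RatFunc.C a * RatFunc.C d - RatFunc.C b * RatFunc.C c = 0 := by
      rw [← map_mul, ← map_mul, ← map_sub, h0, map_zero]
    have hac : RatFunc.C c * (σ : RatMap).fn + RatFunc.C (-a) = 0 := by
      refine mul_right_cancel₀ hcd ?_
      rw [map_neg]
      linear_combination RatFunc.C c * hσ - hdet0
    have hbd : RatFunc.C d * (σ : RatMap).fn + RatFunc.C (-b) = 0 := by
      refine mul_right_cancel₀ hcd ?_
      rw [map_neg]
      linear_combination RatFunc.C d * hσ + RatFunc.X * hdet0
    refine hcd ?_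
    rw [((C_mul_fn_add_C_eq_zero_iff _).mp hac).1, ((C_mul_fn_add_C_eq_zero_iff _).mp hbd).1,
      map_zero, zero_mul, add_zero]
  exact ⟨GeneralLinearGroup.mkOfDetNeZero _ hdet, Units.ext (RatMap.ext hσ.symm)⟩

theorem eq_of_toMoebius_eq {g u v : GL (Fin 2) ℂ} {s t : ℂ} (hg : toMoebius g ≠ 1)
    (hu : (u : Matrix (Fin 2) (Fin 2) ℂ) = algebraMap _ _ s - g)
    (hv : (v : Matrix (Fin 2) (Fin 2) ℂ) = algebraMap _ _ t - g)
    (huv : toMoebius u = toMoebius v) : s = t := by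
  obtain ⟨c, hc⟩ := toMoebius_eq_one_iff.mp
    (show toMoebius (u⁻¹ * v) = 1 by rw [map_mul, map_inv, inv_mul_eq_one, huv])
  have huc : (algebraMap _ _ s - g) * algebraMap ℂ (Matrix (Fin 2) (Fin 2) ℂ) c =
      algebraMap _ _ t - g := by
    rw [hc, ← hu, ← hv, ← Units.val_mul, mul_inv_cancel_left]
  have hscalar : (c - 1) • (g : Matrix (Fin 2) (Fin 2) ℂ) = algebraMap _ _ (s * c - t) := by
    rw [sub_mul, ← map_mul, ← Algebra.commutes, ← Algebra.smul_def] at huc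
    rw [sub_smul, one_smul, map_sub, sub_eq_sub_iff_sub_eq_sub, ← neg_sub, huc, neg_sub]
  rcases eq_or_ne c 1 with rfl | hc1
  · rw [sub_self, zero_smul, mul_one] at hscalar
    exact sub_eq_zero.mp ((map_eq_zero_iff _ (algebraMap ℂ _).injective).mp hscalar.symm)
  · refine absurd (toMoebius_eq_one_iff.mpr ⟨(c - 1)⁻¹ * (s * c - t), ?_⟩) hg
    rw [map_mul, ← hscalar, ← Algebra.smul_def, inv_smul_smul₀ (sub_ne_zero.mpr hc1)]

theorem infinite_centralizer {σ : Moebius} (hσ : σ ≠ 1) :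
    (Subgroup.centralizer {σ} : Set Moebius).Infinite := by
  obtain ⟨g, rfl⟩ := toMoebius_surjective σ
  have hfin := Matrix.finite_spectrum (g : Matrix (Fin 2) (Fin 2) ℂ)
  choose! u hu using fun t (ht : t ∈ (spectrum ℂ (g : Matrix (Fin 2) (Fin 2) ℂ))ᶜ) =>
    spectrum.notMem_iff.mp ht
  refine (hfin.infinite_compl.image (f := fun t => toMoebius (u t)) ?_).mono ?_
  · exact fun s hs t ht hst => eq_of_toMoebius_eq hσ (hu s hs) (hu t ht) hst
  · rintro _ ⟨t, ht, rfl⟩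
    refine Subgroup.mem_centralizer_singleton_iff.mpr ?_
    have hcomm : u t * g = g * u t := Units.ext <| by
      rw [Units.val_mul, Units.val_mul, hu t ht, sub_mul, mul_sub, Algebra.commutes]
    rw [← map_mul, hcomm, map_mul]

theorem Indecomposable.symSigma_eq_bot {A : RatMap} (hA : A.Indecomposable)
    (h : A.symGHat = ⊥) : A.symSigma = ⊥ := by
  rw [Subgroup.eq_bot_iff_forall]
  intro σ hσ
  by_contra hσ1
  exact infinite_centralizer hσ1 <| A.finite_symSigma.subset <|
    (hA.centralizer_le_symG hσ hσ1).trans (symG_le_symSigma h)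

end RatMap

theorem theorem5p5 (A : RatMap) (hdeg : 2 ≤ A.degree) (hA : A.Indecomposable) :
    (A.symGHat = ⊥ → A.symSigmaInf = A.symSigma) ∧
    (A.symG = ⊥ → A.symSigmaInf = ⊥) ∧
    (A.symG = A.symAut → A.symSigmaInf = ⊥) := by
  refine ⟨fun h => ?_, fun h => ?_, fun h => ?_⟩
  · have hS : A.symSigma = ⊥ := hA.symSigma_eq_bot h
    rw [hS, hA.symSigmaInf_eq_bot hS]
  · have hS : A.symSigma = ⊥ := eq_bot_iff.mpr (h ▸ A.symSigma_le_symG)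
    exact hA.symSigmaInf_eq_bot hS
  · have hS : A.symSigma = ⊥ := by
      rw [← A.symSigma_inf_symAut, ← h, inf_eq_left.mpr A.symSigma_le_symG]
    exact hA.symSigmaInf_eq_bot hS
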